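/- Let $T$ be an arbitrary first-order theory in a language $L$ (not assumed dependent), and let $\mathfrak C$ be a monster model of $T$, that is, a model of $T$ which is $\kappa$-saturated and strongly $\kappa$-homogeneous for some cardinal $\kappa>|L|+\aleph_0$. Let $A\subseteq\mathfrak C$ with $|A|<\kappa$. A sequence $(b_i)_{i\in I}$ of finite tuples of a fixed length, indexed by an infinite linear order $I$, is \emph{indiscernible over} a set $B\subseteq\mathfrak C$ if $\operatorname{tp}(b_{i_1}\cdots b_{i_m}/B)=\operatorname{tp}(b_{j_1}\cdots b_{j_m}/B)$ for all $m$ and all $i_1<\dots<i_m$, $j_1<\dots<j_m$ in $I$. A family of such sequences is \emph{mutually indiscernible over} $B$ if each of them is indiscernible over the union of $B$ and (the elements of) all the other sequences. For a partial type $p(x)$ over $A$ and a cardinal $\mu$, write $\operatorname{dp-rk}(p)\le\mu$ if for every realization $a$ of $p$ and every family of $1+\mu$ sequences that are mutually indiscernible over $A$, at least one of the sequences is indiscernible over $Aa$. \textbf{Theorem.} Let $a_1,a_2$ be finite tuples in $\mathfrak C$ and let $k_1,k_2$ be natural numbers such that $\operatorname{dp-rk}(\operatorname{tp}(a_i/A))\le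 k_i$ for $i\in\{1,2\}$. Then $\operatorname{dp-rk}(\operatorname{tp}(a_1a_2/A))\le k_1+k_2$. -/

import Mathlib

universe u v w x x₁ x₂ y

namespace DpRank

open FirstOrder

variable (L : FirstOrder.Language.{u, v}) {M : Type w} [L.Structure M]

/-- A set `p` of formulas with parameters in `A` is finitely satisfiable in `M`. -/
def FinitelySatisfiable (A : Set M) {α : Type x} (p : Set (L[[A]].Formula α)) : Prop :=
  ∀ F : Finset (L[[A]].Formula α), (F : Set (L[[A]].Formula α)) ⊆ p →
    ∃ a : α → M, ∀ φ ∈ F, φ.Realize a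

/-- The tuple `a` realizes the set `p` of formulas with parameters in `A`. -/
def Realizes (A : Set M) {α : Type x} (p : Set (L[[A]].Formula α)) (a : α → M) : Prop :=
  ∀ φ ∈ p, φ.Realize a

/-- The complete type `tp(a/A)`: all formulas with parameters in `A` that hold of the tuple `a`. -/
def tp (A : Set M) {α : Type x} (a : α → M) : Set (L[[A]].Formula α) :=
  {φ | φ.Realize a}

/-- `κ`-saturation: every finitely satisfiable set of formulas in one variable with fewer than `κ`
parameters is realized. -/
def IsSaturated (κ : Cardinal.{w}) (M : Type w) [L.Structure M] : Prop :=
  ∀ A : Set M, Cardinal.mk A < κ → ∀ p : Set (L[[A]].Formula (Fin 1)),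
    FinitelySatisfiable L A p → ∃ a : Fin 1 → M, Realizes L A p a

/-- Strong `κ`-homogeneity: every partial elementary map `f : A → M` with domain of size less than
`κ` extends to an automorphism of `M`. -/
def IsStronglyHomogeneous (κ : Cardinal.{w}) (M : Type w) [L.Structure M] : Prop :=
  ∀ A : Set M, Cardinal.mk A < κ → ∀ f : A → M,
    (∀ φ : L.Formula A, φ.Realize (fun c : A => (c : M)) ↔ φ.Realize f) →
      ∃ g : M ≃[L] M, ∀ c : A, g c = f c

variable {L} in
/-- `M` is a `κ`-monster model of `T`, where `κ > |L| + ℵ₀`; sets of size less than `κ` are the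
small ones. -/
structure IsMonster (T : L.Theory) (κ : Cardinal.{w}) (M : Type w) [L.Structure M] : Prop where
  models : M ⊨ T
  aleph0_lt : Cardinal.aleph0 < κ
  card_lt : Cardinal.lift.{w} L.card < Cardinal.lift.{max u v} κ
  saturated : IsSaturated L κ M
  homogeneous : IsStronglyHomogeneous L κ M

/-- A sequence `b` of `n`-tuples, indexed by a linear order `I`, is indiscernible over `A`: any two
finite increasing subsequences of the same length have the same type over `A`. -/
def Indiscernible (A : Set M) {I : Type y} [LinearOrder I] {n : ℕ} (b : I → Fin n → M) : Prop :=
  ∀ (m : ℕ) (s t : Fin m → I), StrictMono s → StrictMono t →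
    tp L A (fun q : Fin m × Fin n => b (s q.1) q.2) =
      tp L A (fun q : Fin m × Fin n => b (t q.1) q.2)

/-- The set of all coordinates of all terms of a sequence of tuples. -/
def entries {I : Type y} {n : ℕ} (b : I → Fin n → M) : Set M :=
  {c | ∃ (i : I) (l : Fin n), b i l = c}

/-- The sequences `b j` (`j : J`) are mutually indiscernible over `A`: each of them is
indiscernible over `A` together with all the other sequences. The index orders and the lengths of
the tuples may depend on `j`. -/
def MutuallyIndiscernible (A : Set M) {J : Type y} {I : J → Type y} [∀ j, LinearOrder (I j)]
    {n : J → ℕ} (b : (j : J) → I j → Fin (n j) → M) : Prop :=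
  ∀ j : J, Indiscernible L (A ∪ ⋃ j' ∈ {j' : J | j' ≠ j}, entries (b j')) (b j)

/-- `dp-rk(p) ≤ μ` for a partial type `p` over `A`: for every realization `a` of `p` and every
family of `1 + μ` infinite sequences (of finite tuples) that are mutually indiscernible over `A`,
at least one of the sequences is indiscernible over `Aa`. -/
def DpRankLE (A : Set M) {α : Type x} (p : Set (L[[A]].Formula α)) (μ : Cardinal.{y}) : Prop :=
  ∀ a : α → M, Realizes L A p a →
    ∀ (J : Type y), Cardinal.mk J = 1 + μ →
      ∀ (I : J → Type y) [∀ j, LinearOrder (I j)] [∀ j, Infinite (I j)] (n : J → ℕ)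
        (b : (j : J) → I j → Fin (n j) → M),
        MutuallyIndiscernible L A b → ∃ j : J, Indiscernible L (A ∪ Set.range a) (b j)

end DpRank

-- The heart is `RankLE.exists_mutuallyIndiscernibleOn`: if `a` has rank at most `k` over `A`, then
-- among `k + r` sequences mutually indiscernible over `A`, some `r` remain so over `Aa`. Take `k =
-- k₁`, `r = k₂ + 1` and `a = a₁`. By `RankLE.mono`, `a₂` has rank at most `k₂` over `Aa₁`, so one
-- surviving sequence is indiscernible over `Aa₁a₂`.
--
-- The key lemma goes by induction on `r`. For each `j`, induction over `A` and `b j` gives `r`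
-- other sequences `S j`, mutually indiscernible over `A`, `a` and `b j`. If no `b j` can be added
-- to its `S j`, cut all sequences above the finitely many indices that witness this. The initial
-- segments are mutually indiscernible over the final ones, so for some `j` that of `b j` is
-- indiscernible over `Aa` and all final segments. But the sequences in `S j` can slide into their
-- final segments without changing their type over `A`, `a` and `b j`, a contradiction.
--
-- Sliding needs a dense index order. Saturation provides one while keeping the finitely many terms
-- that witness a failure (`MutuallyIndiscernibleOn.exists_dense`).

namespace DpRank

open FirstOrder

variable (L : FirstOrder.Language.{u, v}) {M : Type w} [L.Structure M]

/-- Two assignments of the variables in `X` satisfy the same formulas. -/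
def SameType {X : Type*} (f g : X → M) : Prop :=
  ∀ φ : L.Formula X, φ.Realize f ↔ φ.Realize g

variable {L}

-- Types as assignments satisfying the same formulas

section SameType

variable {X Y : Type*} {f g h : X → M}

theorem SameType.symm (hfg : SameType L f g) : SameType L g f := fun φ => (hfg φ).symm

theorem SameType.trans (hfg : SameType L f g) (hgh : SameType L g h) : SameType L f h :=
  fun φ => (hfg φ).trans (hgh φ)

/-- Relabelling variables transfers equality of types; all later bookkeeping reduces to matching
variables this way. -/
theorem SameType.of_exists {F G : Y → M} (hFG : SameType L F G)
    (hr : ∀ x, ∃ y, F y = f x ∧ G y = g x) : SameType L f g := by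
  choose r hF hG using hr
  obtain rfl : F ∘ r = f := funext hF
  obtain rfl : G ∘ r = g := funext hG
  intro φ
  rw [← Language.Formula.realize_relabel, ← Language.Formula.realize_relabel]
  exact hFG _

/-- Every formula depends only on finitely many variables. -/
theorem exists_formula_finset (φ : L.Formula X) : ∃ (s : Finset X) (ψ : L.Formula s),
    ∀ f : X → M, ψ.Realize (fun x : s => f x) ↔ φ.Realize f := by
  classical
  exact ⟨φ.freeVarFinset, φ.restrictFreeVar id, fun f =>
    Language.BoundedFormula.realize_restrictFreeVar f (fun _ => rfl)⟩

theorem sameType_of_finset (H : ∀ s : Finset X, SameType L (fun x : s => f x) (fun x : s => g x)) :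
    SameType L f g := by
  intro φ
  obtain ⟨s, ψ, hψ⟩ := exists_formula_finset (M := M) φ
  rw [← hψ f, ← hψ g]
  exact H s ψ

theorem realize_constantsVarsEquiv {A : Set M} {α : Type*} (φ : L[[A]].Formula α) (a : α → M) :
    Language.Formula.Realize (L := L) (Language.BoundedFormula.constantsVarsEquiv φ)
      (Sum.elim (Subtype.val : A → M) a) ↔ φ.Realize a :=
  Language.BoundedFormula.realize_constantsVarsEquiv

/-- Parameters become variables assigned to themselves, so the base can change while the language
stays fixed. -/
theorem tp_eq_tp_iff {A : Set M} {α : Type*} {a b : α → M} :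
    tp L A a = tp L A b ↔
      SameType L (Sum.elim (Subtype.val : A → M) a) (Sum.elim (Subtype.val : A → M) b) := by
  constructor
  · intro H φ
    obtain ⟨ψ, rfl⟩ := (Language.BoundedFormula.constantsVarsEquiv (L := L)).surjective φ
    exact (realize_constantsVarsEquiv ψ a).trans
      ((Set.ext_iff.1 H ψ).trans (realize_constantsVarsEquiv ψ b).symm)
  · intro H
    ext φ
    exact (realize_constantsVarsEquiv φ a).symm.trans
      ((H _).trans (realize_constantsVarsEquiv φ b))

/-- The projection of a formula to a set of variables is given by a formula. -/
theorem exists_formula_proj (φ : L.Formula X) (D : Set X) : ∃ ψ : L.Formula D,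
    ∀ f : X → M, ψ.Realize (fun d : D => f d) ↔ ∃ g : X → M, Set.EqOn g f D ∧ φ.Realize g := by
  classical
  obtain ⟨s, θ, hθ⟩ := exists_formula_finset (M := M) φ
  refine ⟨(θ.relabel (fun x : s => if hx : (x : X) ∈ D then (Sum.inl ⟨x, hx⟩ : D ⊕ s)
    else Sum.inr x)).iExs s, fun f => ?_⟩
  rw [Language.Formula.realize_iExs]
  simp only [Language.Formula.realize_relabel]
  constructor
  · rintro ⟨c, hc⟩
    refine ⟨fun x => if x ∈ D then f x else if hx : x ∈ s then c ⟨x, hx⟩ else f x,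
      fun x hx => if_pos hx, ?_⟩
    rw [← hθ]
    convert hc using 1
    funext x
    by_cases hx : (x : X) ∈ D <;> simp [hx]
  · rintro ⟨g, hg, hφ⟩
    refine ⟨fun x => g x, ?_⟩
    rw [← hθ] at hφ
    convert hφ using 1
    funext x
    by_cases hx : (x : X) ∈ D <;> simp [hx]
    exact (hg hx).symm

theorem SameType.exists_extension {D : Set X}
    (H : SameType L (fun d : D => f d) (fun d : D => g d)) {φ : L.Formula X} (hφ : φ.Realize g) :
    ∃ g' : X → M, Set.EqOn g' f D ∧ φ.Realize g' := by
  obtain ⟨ψ, hψ⟩ := exists_formula_proj (M := M) φ D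
  exact (hψ f).1 ((H ψ).2 ((hψ g).2 ⟨g, fun _ _ => rfl, hφ⟩))

end SameType

-- Indiscernible sequences

section Indiscernible

variable {A B : Set M} {I : Type*} [LinearOrder I] {n : ℕ} {b : I → Fin n → M}

/-- A formula mentions finitely many places, so `I₀` may be infinite and whole segments can be moved
at once. -/
theorem Indiscernible.sameType (hb : Indiscernible L A b) {X : Type*} {f : X → M}
    (hf : ∀ x, f x ∈ A) {I₀ : Type*} [LinearOrder I₀] {s t : I₀ → I} (hs : StrictMono s)
    (ht : StrictMono t) :
    SameType L (Sum.elim f (fun z : I₀ × Fin n => b (s z.1) z.2))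
      (Sum.elim f (fun z : I₀ × Fin n => b (t z.1) z.2)) := by
  classical
  refine sameType_of_finset fun S => ?_
  let T : Finset I₀ := S.biUnion fun z => Sum.elim (fun _ => ∅) (fun p => {p.1}) z
  have key := tp_eq_tp_iff.1 (hb T.card (s ∘ T.orderEmbOfFin rfl) (t ∘ T.orderEmbOfFin rfl)
    (hs.comp (T.orderEmbOfFin rfl).strictMono) (ht.comp (T.orderEmbOfFin rfl).strictMono))
  refine key.of_exists ?_
  rintro ⟨x | ⟨i, l⟩, hz⟩
  · exact ⟨Sum.inl ⟨f x, hf x⟩, rfl, rfl⟩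
  · have hi : i ∈ T := Finset.mem_biUnion.2 ⟨_, hz, by simp⟩
    obtain ⟨k, hk⟩ : i ∈ Set.range (T.orderEmbOfFin rfl) := by
      rw [Finset.range_orderEmbOfFin]; exact hi
    exact ⟨Sum.inr (k, l), by simp [hk], by simp [hk]⟩

theorem indiscernible_of_sameType {X : Type*} {f : X → M} (hf : A ⊆ Set.range f)
    (H : ∀ (m : ℕ) (s t : Fin m → I), StrictMono s → StrictMono t →
      SameType L (Sum.elim f (fun z : Fin m × Fin n => b (s z.1) z.2))
        (Sum.elim f (fun z : Fin m × Fin n => b (t z.1) z.2))) : Indiscernible L A b := by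
  intro m s t hs ht
  refine tp_eq_tp_iff.2 ((H m s t hs ht).of_exists ?_)
  rintro (⟨a, ha⟩ | z)
  · obtain ⟨x, rfl⟩ := hf ha
    exact ⟨Sum.inl x, rfl, rfl⟩
  · exact ⟨Sum.inr z, rfl, rfl⟩

theorem Indiscernible.mono (hb : Indiscernible L B b) (hAB : A ⊆ B) : Indiscernible L A b :=
  indiscernible_of_sameType (f := (Subtype.val : A → M)) (by simp)
    fun _ _ _ hs ht => hb.sameType (fun x => hAB x.2) hs ht

/-- Failure of indiscernibility over a set is witnessed by a finite subset of it. -/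
theorem exists_finset_of_not_indiscernible (hb : ¬ Indiscernible L A b) :
    ∃ F : Finset M, (F : Set M) ⊆ A ∧ ∃ (m : ℕ) (s t : Fin m → I), StrictMono s ∧ StrictMono t ∧
      ¬ SameType L (Sum.elim (Subtype.val : F → M) (fun z : Fin m × Fin n => b (s z.1) z.2))
        (Sum.elim (Subtype.val : F → M) (fun z : Fin m × Fin n => b (t z.1) z.2)) := by
  classical
  by_contra! H
  refine hb (indiscernible_of_sameType (f := (Subtype.val : A → M)) (by simp)
    fun m s t hs ht => sameType_of_finset fun S => ?_)
  have := H (S.biUnion fun z => Sum.elim (fun x : A => {(x : M)}) (fun _ => ∅) z) (by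
    intro c hc
    simp only [Finset.coe_biUnion, Set.mem_iUnion] at hc
    obtain ⟨x | z, -, hc⟩ := hc
    · simp at hc; subst hc; exact x.2
    · simp at hc) m s t hs ht
  refine this.of_exists ?_
  rintro ⟨x | z, hz⟩
  · exact ⟨Sum.inl ⟨x, Finset.mem_biUnion.2 ⟨_, hz, by simp⟩⟩, rfl, rfl⟩
  · exact ⟨Sum.inr z, rfl, rfl⟩

end Indiscernible

-- Mutually indiscernible families

section Mutual

variable {J : Type y} {I : J → Type x} [∀ j, LinearOrder (I j)] {n : J → ℕ}

variable (L) in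
/-- The sequences `b j` with `j ∈ K` are mutually indiscernible over `A`. -/
def MutuallyIndiscernibleOn (A : Set M) (K : Set J) (b : (j : J) → I j → Fin (n j) → M) : Prop :=
  ∀ j ∈ K, Indiscernible L (A ∪ {c | ∃ j' ∈ K, j' ≠ j ∧ c ∈ entries (b j')}) (b j)

variable {A : Set M} {K : Set J} {b : (j : J) → I j → Fin (n j) → M}

/-- Indices of finitely many mutually indiscernible sequences can be moved independently. -/
theorem MutuallyIndiscernibleOn.sameType (h : MutuallyIndiscernibleOn L A K b) (hK : K.Finite)
    {X : Type*} {f : X → M} (hf : ∀ x, f x ∈ A) {I₀ : J → Type*} [∀ j, LinearOrder (I₀ j)]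
    {s t : ∀ j, I₀ j → I j} (hs : ∀ j, StrictMono (s j)) (ht : ∀ j, StrictMono (t j)) :
    SameType L (Sum.elim f (fun z : Σ j : K, I₀ j × Fin (n j) => b z.1 (s z.1 z.2.1) z.2.2))
      (Sum.elim f (fun z : Σ j : K, I₀ j × Fin (n j) => b z.1 (t z.1 z.2.1) z.2.2)) := by
  classical
  have step : ∀ (u v : ∀ j, I₀ j → I j), (∀ j, StrictMono (u j)) → (∀ j, StrictMono (v j)) →
      ∀ j₀ ∈ K, (∀ j, j ≠ j₀ → u j = v j) →
      SameType L (Sum.elim f (fun z : Σ j : K, I₀ j × Fin (n j) => b z.1 (u z.1 z.2.1) z.2.2))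
        (Sum.elim f (fun z : Σ j : K, I₀ j × Fin (n j) => b z.1 (v z.1 z.2.1) z.2.2)) := by
    intro u v hu hv j₀ hj₀ huv
    refine ((h j₀ hj₀).sameType (X := X ⊕ {z : Σ j : K, I₀ j × Fin (n j) // (z.1 : J) ≠ j₀})
      (f := Sum.elim f fun z => b z.1.1 (u z.1.1 z.1.2.1) z.1.2.2) ?_ (hu j₀) (hv j₀)).of_exists ?_
    · rintro (x | ⟨⟨j, i, l⟩, hz⟩)
      · exact Or.inl (hf x)
      · exact Or.inr ⟨j, j.2, hz, _, _, rfl⟩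
    · rintro (x | ⟨⟨j, hj⟩, i, l⟩)
      · exact ⟨Sum.inl (Sum.inl x), rfl, rfl⟩
      · by_cases hjj : j = j₀
        · subst hjj
          exact ⟨Sum.inr (i, l), rfl, rfl⟩
        · exact ⟨Sum.inl (Sum.inr ⟨⟨⟨j, hj⟩, i, l⟩, hjj⟩), rfl, by simp [huv j hjj]⟩
  -- Hybrids: pass from `s` to `t` one sequence at a time, the other sequences serving as
  -- parameters.
  let w : Set J → ∀ j, I₀ j → I j := fun F j => if j ∈ F then t j else s j
  have hw : ∀ F j, StrictMono (w F j) := by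
    intro F j
    simp only [w]
    split_ifs <;> simp [hs, ht]
  have main : ∀ F : Set J, F.Finite → F ⊆ K →
      SameType L (Sum.elim f (fun z : Σ j : K, I₀ j × Fin (n j) => b z.1 (s z.1 z.2.1) z.2.2))
        (Sum.elim f (fun z : Σ j : K, I₀ j × Fin (n j) => b z.1 (w F z.1 z.2.1) z.2.2)) := by
    intro F hF
    induction F, hF using Set.Finite.induction_on with
    | empty => exact fun _ φ => by simp [w]
    | @insert j₀ F hj₀ _ ih =>
      intro hFK
      refine (ih ((Set.subset_insert _ _).trans hFK)).trans
        (step (w F) (w (insert j₀ F)) (hw _) (hw _) j₀ (hFK (Set.mem_insert _ _)) ?_)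
      intro j hj
      simp [w, hj]
  refine (main K hK le_rfl).of_exists ?_
  rintro (x | ⟨⟨j, hj⟩, i, l⟩)
  · exact ⟨Sum.inl x, rfl, rfl⟩
  · exact ⟨Sum.inr ⟨⟨j, hj⟩, i, l⟩, rfl, by simp [w]⟩

end Mutual

-- Rank bounds and enlarging the base

section Rank

variable {α : Type*} {A B : Set M} {a : α → M} {k : ℕ}

variable (L) in
/-- Among more than `k` sequences which are mutually indiscernible over `A`, at least one is
indiscernible over `A` and the tuple `a`. -/
def RankLE (A : Set M) (a : α → M) (k : ℕ) : Prop :=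
  ∀ (J : Type y) [Finite J], k < Nat.card J →
    ∀ (I : J → Type y) [∀ j, LinearOrder (I j)] [∀ j, Infinite (I j)] (n : J → ℕ)
      (b : (j : J) → I j → Fin (n j) → M),
      MutuallyIndiscernibleOn L A Set.univ b → ∃ j : J, Indiscernible L (A ∪ Set.range a) (b j)

theorem mutuallyIndiscernible_iff {J : Type y} {I : J → Type y} [∀ j, LinearOrder (I j)]
    {n : J → ℕ} {b : (j : J) → I j → Fin (n j) → M} :
    MutuallyIndiscernible L A b ↔ MutuallyIndiscernibleOn L A Set.univ b := by
  have : ∀ j : J, (⋃ j' ∈ {j' : J | j' ≠ j}, entries (b j')) =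
      {c | ∃ j' ∈ Set.univ, j' ≠ j ∧ c ∈ entries (b j')} := by
    intro j
    ext c
    simp
  simp only [MutuallyIndiscernible, MutuallyIndiscernibleOn, this, Set.mem_univ, true_imp_iff]

theorem DpRankLE.rankLE {β : Type*} {p : Set (L[[A]].Formula β)} {a : β → M}
    (h : DpRankLE L A p (k : Cardinal.{y})) (ha : Realizes L A p a) : RankLE.{u, v, w, y} L A a k := by
  intro J _ hJ I _ _ n b hb
  have := Fintype.ofFinite J
  rw [Nat.card_eq_fintype_card, ← Finset.card_univ] at hJ
  obtain ⟨F, -, hF⟩ := Finset.exists_subset_card_eq (Nat.succ_le_of_lt hJ)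
  obtain ⟨j, hj⟩ := h a ha F (by simp [hF, add_comm]) (fun j => I j) (fun j => n j)
    (fun j => b j) (mutuallyIndiscernible_iff.2 fun j _ => (hb j trivial).mono
      (Set.union_subset_union_right _ fun c ⟨j', _, hne, hc⟩ =>
        ⟨j', trivial, fun h => hne (Subtype.ext h), hc⟩))
  exact ⟨j, hj⟩

/-- Finitely many elements of `B` witness all failures at once. Appended to every term as a constant
tuple `d`, they are carried by the sequences themselves, so the bound over `A` applies. -/
theorem RankLE.mono (h : RankLE.{u, v, w, y} L A a k) (hAB : A ⊆ B) :
    RankLE.{u, v, w, y} L B a k := by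
  classical
  intro J _ hJ I _ _ n b hb
  by_contra! H
  choose F hF m s t hs ht hst using fun j => exists_finset_of_not_indiscernible (H j)
  have hD : (⋃ j, (F j : Set M) ∩ B).Finite :=
    Set.finite_iUnion fun j => (F j).finite_toSet.inter_of_left _
  obtain ⟨r, d, -, hd⟩ := hD.fin_param
  have hdB : ∀ i, d i ∈ B := by
    intro i
    have := hd ▸ Set.mem_range_self i
    obtain ⟨j, hj⟩ := Set.mem_iUnion.1 this
    exact hj.2
  obtain ⟨j, hj⟩ := h J hJ I (fun j => n j + r) (fun j i => Fin.append (b j i) d) (by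
    intro j _
    let C : Set M := A ∪ {c | ∃ j' ∈ Set.univ, j' ≠ j ∧
      c ∈ entries (fun i => Fin.append (b j' i) d)}
    refine indiscernible_of_sameType (f := (Subtype.val : C → M)) Subtype.range_val.ge fun m s t hs ht =>
      ((hb j trivial).sameType (f := Sum.elim (Subtype.val : C → M) d) ?_ hs ht).of_exists ?_
    · rintro (⟨c, hc | ⟨j', -, hne, i, l, rfl⟩⟩ | i)
      · exact Or.inl (hAB hc)
      · refine Fin.addCases (fun l => ?_) (fun l => ?_) l
        · simp only [Sum.elim_inl, Fin.append_left]
          exact Or.inr ⟨j', trivial, hne, i, l, rfl⟩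
        · simp only [Sum.elim_inl, Fin.append_right]
          exact Or.inl (hdB l)
      · exact Or.inl (hdB i)
    · rintro (c | ⟨i, l⟩)
      · exact ⟨Sum.inl (Sum.inl c), rfl, rfl⟩
      · refine Fin.addCases (fun l => ?_) (fun l => ?_) l
        · exact ⟨Sum.inr (i, l), by simp, by simp⟩
        · exact ⟨Sum.inl (Sum.inr l), by simp, by simp⟩)
  refine hst j ?_
  -- Below, `d` is read off the first term, so the case of no terms is separate.
  rcases Nat.eq_zero_or_pos (m j) with hm | hm
  · have : IsEmpty (Fin (m j)) := by rw [hm]; infer_instance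
    rw [Subsingleton.elim (s j) (t j)]
    exact fun _ => Iff.rfl
  · refine (hj.sameType (f := (Subtype.val : (A ∪ Set.range a : Set M) → M)) (fun c => c.2)
      (hs j) (ht j)).of_exists ?_
    rintro (⟨c, hc⟩ | ⟨i, l⟩)
    · rcases hF j hc with hcB | hca
      · obtain ⟨i, rfl⟩ : c ∈ Set.range d := hd ▸ Set.mem_iUnion.2 ⟨j, hc, hcB⟩
        exact ⟨Sum.inr (⟨0, hm⟩, Fin.natAdd _ i), by simp, by simp⟩
      · exact ⟨Sum.inl ⟨c, Or.inr hca⟩, rfl, rfl⟩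
    · exact ⟨Sum.inr (i, Fin.castAdd _ l), by simp, by simp⟩

end Rank

-- The key lemma over a dense index order

section Dense

variable {Q J : Type y} [LinearOrder Q] {n : J → ℕ} {b : (j : J) → Q → Fin (n j) → M}

/-- Initial segments of mutually indiscernible sequences are mutually indiscernible over the
corresponding final segments. -/
theorem MutuallyIndiscernibleOn.initialSegment {A : Set M} {K : Set J}
    (h : MutuallyIndiscernibleOn L A K b) (q : Q) :
    MutuallyIndiscernibleOn L (A ∪ {c | ∃ j ∈ K, ∃ x, q ≤ x ∧ ∃ l, b j x l = c}) Set.univ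
      (fun (j : K) (x : Set.Iio q) => b j x) := by
  rintro ⟨j, hj⟩ -
  refine indiscernible_of_sameType (f := Subtype.val) (Subtype.range_val).ge
    fun m s t hs ht => ?_
  -- A tuple below `q` followed by the whole final segment is still increasing, so the tuple moves
  -- while the final segment stays fixed.
  let ext : (Fin m → Set.Iio q) → (Fin m ⊕ₗ Set.Ici q) → Q :=
    fun s z => Sum.elim (fun i => (s i : Q)) Subtype.val (ofLex z)
  have hext : ∀ s : Fin m → Set.Iio q, StrictMono s → StrictMono (ext s) := by
    intro s hs z z' hzz
    rcases Sum.Lex.lt_def.1 hzz with h | h | h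
    · exact hs h
    · exact h
    · exact lt_of_lt_of_le (s _).2 (Subtype.prop _)
  refine ((h j hj).sameType (f := Subtype.val) (fun c => c.2) (hext s hs) (hext t ht)).of_exists ?_
  rintro (⟨c, (hc | ⟨j', hj', x, hx, l, rfl⟩) | ⟨j', -, hne, x, l, rfl⟩⟩ | ⟨i, l⟩)
  · exact ⟨Sum.inl ⟨c, Or.inl hc⟩, rfl, rfl⟩
  · by_cases hjj : j' = j
    · subst hjj
      exact ⟨Sum.inr (toLex (Sum.inr ⟨x, hx⟩), l), rfl, rfl⟩
    · exact ⟨Sum.inl ⟨_, Or.inr ⟨j', hj', hjj, x, l, rfl⟩⟩, rfl, rfl⟩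
  · exact ⟨Sum.inl ⟨_, Or.inr ⟨j', j'.2, fun h => hne (Subtype.ext h), x, l, rfl⟩⟩, rfl, rfl⟩
  · exact ⟨Sum.inr (toLex (Sum.inl i), l), rfl, rfl⟩

/-- If `a` has rank at most `k` over `A`, then all but `k` of the members of a finite family of
sequences which are mutually indiscernible over `A` are mutually indiscernible over `A` and `a`. -/
theorem RankLE.exists_mutuallyIndiscernibleOn [Countable Q] [Nonempty Q] [DenselyOrdered Q]
    [NoMinOrder Q] [NoMaxOrder Q] {α : Type*} {a : α → M} {k : ℕ} (r : ℕ) :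
    ∀ (A : Set M) (K : Finset J), RankLE.{u, v, w, y} L A a k → K.card = k + r →
      MutuallyIndiscernibleOn L A K b →
      ∃ S ⊆ K, S.card = r ∧ MutuallyIndiscernibleOn L (A ∪ Set.range a) S b := by
  classical
  induction r with
  | zero => exact fun A K _ _ _ => ⟨∅, by simp, rfl, by simp [MutuallyIndiscernibleOn]⟩
  | succ r ih =>
    intro A K hR hcard hK
    by_contra hno
    have hS : ∀ j ∈ K, ∃ S ⊆ K.erase j, S.card = r ∧
        MutuallyIndiscernibleOn L (A ∪ entries (b j) ∪ Set.range a) S b := by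
      intro j hj
      refine ih _ _ (hR.mono Set.subset_union_left) ?_ fun j' hj' => ?_
      · rw [Finset.card_erase_of_mem hj, hcard]; rfl
      · rw [Finset.mem_coe, Finset.mem_erase] at hj'
        refine (hK j' hj'.2).mono ?_
        rintro c ((hc | hc) | ⟨i, hi, hne, hc⟩)
        · exact Or.inl hc
        · exact Or.inr ⟨j, hj, hj'.1.symm, hc⟩
        · exact Or.inr ⟨i, Finset.mem_of_mem_erase hi, hne, hc⟩
    choose! S hSK hScard hSmi using hS
    have hfail : ∀ j : K, ¬ Indiscernible L
        (A ∪ Set.range a ∪ {c | ∃ j' ∈ S j, c ∈ entries (b j')}) (b j) := by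
      rintro ⟨j, hj⟩ hind
      have hjS : j ∉ S j := fun h => Finset.notMem_erase j K (hSK j hj h)
      refine hno ⟨insert j (S j), Finset.insert_subset hj ((hSK j hj).trans (Finset.erase_subset _ _)),
        by rw [Finset.card_insert_of_notMem hjS, hScard j hj], fun i hi => ?_⟩
      rcases Finset.mem_insert.1 hi with rfl | hi
      · refine hind.mono (Set.union_subset_union_right _ ?_)
        rintro c ⟨j', hj', hne, hc⟩
        exact ⟨j', (Finset.mem_insert.1 hj').resolve_left hne, hc⟩
      · refine (hSmi j hj i hi).mono ?_
        rintro c ((hc | hc) | ⟨j', hj', hne, hc⟩)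
        · exact Or.inl (Or.inl (Or.inl hc))
        · exact Or.inl (Or.inr hc)
        · rcases Finset.mem_insert.1 hj' with rfl | hj'
          · exact Or.inl (Or.inl (Or.inr hc))
          · exact Or.inr ⟨j', hj', hne, hc⟩
    choose F hF m s t hs ht hst using fun j => exists_finset_of_not_indiscernible (hfail j)
    obtain ⟨q₀, hq₀⟩ : BddAbove (⋃ j, Set.range (s j) ∪ Set.range (t j)) :=
      (Set.finite_iUnion fun j => (Set.finite_range _).union (Set.finite_range _)).bddAbove
    obtain ⟨q, hq⟩ := exists_gt q₀
    have hsq : ∀ j i, s j i < q := fun j i =>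
      (hq₀ (Set.mem_iUnion.2 ⟨j, Or.inl ⟨i, rfl⟩⟩)).trans_lt hq
    have htq : ∀ j i, t j i < q := fun j i =>
      (hq₀ (Set.mem_iUnion.2 ⟨j, Or.inr ⟨i, rfl⟩⟩)).trans_lt hq
    obtain ⟨⟨j, hj⟩, hind⟩ := hR.mono (B := A ∪ {c | ∃ j ∈ (K : Set J), ∃ x, q ≤ x ∧ ∃ l, b j x l = c})
      Set.subset_union_left (K : Set J) (by simp [hcard]) (fun _ => Set.Iio q) (fun j => n j) _
      (hK.initialSegment q)
    have : Nontrivial (Set.Ioi q) := by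
      obtain ⟨x, hx⟩ := exists_gt q
      obtain ⟨z, hz⟩ := exists_gt x
      exact ⟨⟨x, hx⟩, ⟨z, hx.trans hz⟩, fun h => hz.ne (congrArg Subtype.val h)⟩
    -- `e` slides the sequences in `S j` beyond the cut `q`; `move` does this over `A`, `a` and `b
    -- j`, and `mid` then exchanges `s` for `t` below the cut.
    obtain ⟨e⟩ := Order.embedding_from_countable_to_dense (α := Q) (β := Set.Ioi q)
    have he : StrictMono fun x => (e x : Q) := fun x z hxz => e.strictMono hxz
    have move : ∀ u : Fin (m ⟨j, hj⟩) → Q, SameType L _ _ := fun u =>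
      (hSmi j hj).sameType (S j).finite_toSet
        (f := Sum.elim (Subtype.val : (A ∪ Set.range a : Set M) → M)
          (fun z : Fin (m ⟨j, hj⟩) × Fin (n j) => b j (u z.1) z.2))
        (by
          rintro (⟨c, hc | hc⟩ | z)
          · exact Or.inl (Or.inl hc)
          · exact Or.inr hc
          · exact Or.inl (Or.inr ⟨_, _, rfl⟩))
        (fun _ => strictMono_id) (fun _ => he)
    have mid := hind.sameType (X := (A ∪ Set.range a : Set M) ⊕ Σ j' : (S j : Set J), Q × Fin (n j'))
      (f := Sum.elim Subtype.val fun z => b z.1 (e z.2.1) z.2.2)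
      (by
        rintro (⟨c, hc | hc⟩ | ⟨⟨j', hj'⟩, x, l⟩)
        · exact Or.inl (Or.inl hc)
        · exact Or.inr hc
        · exact Or.inl (Or.inr ⟨j', Finset.mem_of_mem_erase (hSK j hj hj'), e x, (e x).2.le, l, rfl⟩))
      (s := fun i => ⟨s ⟨j, hj⟩ i, hsq _ i⟩) (t := fun i => ⟨t ⟨j, hj⟩ i, htq _ i⟩)
      (hs ⟨j, hj⟩) (ht ⟨j, hj⟩)
    refine hst ⟨j, hj⟩ (((move (s ⟨j, hj⟩)).trans
      ((mid.of_exists ?_).trans (move (t ⟨j, hj⟩)).symm)).of_exists ?_)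
    · rintro ((c | z) | z)
      · exact ⟨Sum.inl (Sum.inl c), rfl, rfl⟩
      · exact ⟨Sum.inr z, rfl, rfl⟩
      · exact ⟨Sum.inl (Sum.inr z), rfl, rfl⟩
    · rintro (⟨c, hc⟩ | z)
      · rcases hF _ hc with hc | ⟨j', hj', x, l, rfl⟩
        · exact ⟨Sum.inl (Sum.inl ⟨c, hc⟩), rfl, rfl⟩
        · exact ⟨Sum.inr ⟨⟨j', hj'⟩, x, l⟩, rfl, rfl⟩
      · exact ⟨Sum.inl (Sum.inr z), rfl, rfl⟩

end Dense

-- Realizing types in countably many variables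

section Saturation

variable {Y : Type*} {q : Set (L.Formula Y)} {D : Set Y} {F : Y → M} {κ : Cardinal.{w}}

/-- Every formula in `q` is satisfied by some assignment that agrees with `F` on `D`. -/
def Extendable (q : Set (L.Formula Y)) (D : Set Y) (F : Y → M) : Prop :=
  ∀ φ ∈ q, ∃ g : Y → M, Set.EqOn g F D ∧ φ.Realize g

theorem Extendable.step (hM : IsSaturated L κ M) (htop : ⊤ ∈ q)
    (hinf : ∀ φ ∈ q, ∀ ψ ∈ q, φ ⊓ ψ ∈ q) (hF : Extendable q D F)
    (hD : Cardinal.mk (F '' D) < κ) (z : Y) :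
    ∃ F' : Y → M, Set.EqOn F' F D ∧ Extendable q (insert z D) F' := by
  classical
  by_cases hz : z ∈ D
  · exact ⟨F, fun _ _ => rfl, by rwa [Set.insert_eq_of_mem hz]⟩
  choose ψ hψ using fun φ : L.Formula Y => exists_formula_proj (M := M) φ (insert z D)
  let ρ : ↥(insert z D) → (F '' D : Set M) ⊕ Fin 1 := fun d =>
    if hd : (d : Y) ∈ D then Sum.inl ⟨F d, Set.mem_image_of_mem F hd⟩ else Sum.inr 0
  -- `θ φ` says of a value for `z` that `φ` has a solution taking it and agreeing with `F` on `D`.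
  let θ : L.Formula Y → L[[(F '' D : Set M)]].Formula (Fin 1) := fun φ =>
    Language.BoundedFormula.constantsVarsEquiv.symm ((ψ φ).relabel ρ)
  have hθ : ∀ φ (a : Fin 1 → M), (θ φ).Realize a ↔
      ∃ g : Y → M, Set.EqOn g (Function.update F z (a 0)) (insert z D) ∧ φ.Realize g := by
    intro φ a
    rw [← hψ, ← realize_constantsVarsEquiv]
    simp only [θ, Equiv.apply_symm_apply, Language.Formula.realize_relabel]
    have : Sum.elim (Subtype.val : (F '' D : Set M) → M) a ∘ ρ =
        fun d : (insert z D : Set Y) => Function.update F z (a 0) d := by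
      funext ⟨d, hd⟩
      by_cases hdD : d ∈ D
      · have : d ≠ z := fun h => hz (h ▸ hdD)
        simp [ρ, hdD, this]
      · obtain rfl : d = z := hd.resolve_right hdD
        simp [ρ, hdD]
    rw [this]
  obtain ⟨a, ha⟩ := hM (F '' D) hD (θ '' q) (by
    intro S hS
    obtain ⟨S', hS', rfl⟩ := Finset.subset_set_image_iff.1 hS
    have : ∃ φ ∈ q, ∀ g : Y → M, φ.Realize g → ∀ χ ∈ S', χ.Realize g := by
      clear hS
      induction S' using Finset.induction_on with
      | empty => exact ⟨⊤, htop, by simp⟩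
      | insert χ S' _ ih =>
        obtain ⟨φ, hφ, H⟩ := ih ((Finset.coe_subset.2 (Finset.subset_insert _ _)).trans hS')
        refine ⟨χ ⊓ φ, hinf _ (hS' (by simp)) _ hφ, fun g hg χ' hχ' => ?_⟩
        have hg := Language.Formula.realize_inf.1 hg
        rcases Finset.mem_insert.1 hχ' with rfl | hχ'
        · exact hg.1
        · exact H g hg.2 χ' hχ'
    obtain ⟨φ, hφ, H⟩ := this
    obtain ⟨g, hg, hφg⟩ := hF φ hφ
    refine ⟨fun _ => g z, fun χ hχ => ?_⟩
    obtain ⟨χ, hχS, rfl⟩ := Finset.mem_image.1 hχ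
    refine (hθ _ _).2 ⟨g, fun d hd => ?_, H g hφg χ hχS⟩
    by_cases hdz : d = z
    · subst hdz; simp
    · rw [Function.update_of_ne hdz]
      exact hg (hd.resolve_left hdz))
  refine ⟨Function.update F z (a 0), fun d hd => Function.update_of_ne (ne_of_mem_of_not_mem hd hz) _ _,
    fun φ hφ => (hθ φ a).1 (ha _ ⟨φ, hφ, rfl⟩)⟩

/-- In a saturated structure, a type in countably many new variables over few elements is
realized. -/
theorem Extendable.exists_realize (hM : IsSaturated L κ M) (hκ : Cardinal.aleph0 < κ)
    (htop : ⊤ ∈ q) (hinf : ∀ φ ∈ q, ∀ ψ ∈ q, φ ⊓ ψ ∈ q) (hF : Extendable q D F)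
    (hD : Cardinal.mk (F '' D) < κ) (hc : Dᶜ.Countable) :
    ∃ G : Y → M, Set.EqOn G F D ∧ ∀ φ ∈ q, φ.Realize G := by
  classical
  rcases Dᶜ.eq_empty_or_nonempty with hDc | hDc
  · rw [Set.compl_empty_iff] at hDc
    refine ⟨F, fun _ _ => rfl, fun φ hφ => ?_⟩
    obtain ⟨g, hg, hφg⟩ := hF φ hφ
    rw [hDc, Set.eqOn_univ] at hg
    exact hg ▸ hφg
  obtain ⟨c, hc⟩ := hc.exists_eq_range hDc
  -- Each stage adds finitely many values to those on `D`, so fewer than `κ` parameters are in use.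
  let E : ℕ → Set Y := fun i => D ∪ c '' Set.Iio i
  have hE : ∀ i, E (i + 1) = insert (c i) (E i) := by
    intro i
    have : Set.Iio (i + 1) = insert i (Set.Iio i) := by
      ext k
      simp only [Set.mem_Iio, Set.mem_insert_iff]
      omega
    simp only [E, this, Set.image_insert_eq, Set.union_insert]
  have hEmono : Monotone E := fun i j hij =>
    Set.union_subset_union_right _ (Set.image_mono (Set.Iio_subset_Iio hij))
  let State : ℕ → Type _ := fun i => {F' : Y → M // Set.EqOn F' F D ∧ Extendable q (E i) F'}
  have next : ∀ i (f : State i), ∃ f' : State (i + 1), Set.EqOn f'.1 f.1 (E i) := by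
    rintro i ⟨f, hfD, hf⟩
    have hcard : Cardinal.mk (f '' E i) < κ := by
      rw [Set.image_union, hfD.image_eq]
      refine (Cardinal.mk_union_le _ _).trans_lt (Cardinal.add_lt_of_lt hκ.le hD ?_)
      exact (Cardinal.lt_aleph0_iff_set_finite.2
        (((Set.finite_Iio i).image c).image f)).trans hκ
    obtain ⟨f', hf', hext⟩ := hf.step hM htop hinf hcard (c i)
    exact ⟨⟨f', (hf'.mono Set.subset_union_left).trans hfD, hE i ▸ hext⟩, hf'⟩
  choose nx hnx using next
  have hE0 : E 0 = D := by simp [E]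
  let f : ∀ i, State i := fun i => Nat.rec ⟨F, fun _ _ => rfl, hE0.symm ▸ hF⟩ (fun i f => nx i f) i
  have hf : ∀ i j, i ≤ j → Set.EqOn (f j).1 (f i).1 (E i) := by
    intro i j hij
    induction j, hij using Nat.le_induction with
    | base => exact fun _ _ => rfl
    | succ j hij ih => exact ((hnx j (f j)).mono (hEmono hij)).trans ih
  have hmem : ∀ z, ∃ i, z ∈ E i := by
    intro z
    by_cases hz : z ∈ D
    · exact ⟨0, Or.inl hz⟩
    · obtain ⟨i, rfl⟩ : z ∈ Set.range c := hc ▸ hz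
      exact ⟨i + 1, Or.inr ⟨i, Nat.lt_succ_self i, rfl⟩⟩
  choose N hN using hmem
  let G : Y → M := fun z => (f (N z)).1 z
  have hG : ∀ i, Set.EqOn G (f i).1 (E i) := by
    intro i z hz
    rcases le_total (N z) i with h | h
    · exact (hf _ _ h (hN z)).symm
    · exact hf _ _ h hz
  refine ⟨G, ((hG 0).mono hE0.ge).trans (f 0).2.1, fun φ hφ => ?_⟩
  obtain ⟨s, ψ, hψ⟩ := exists_formula_finset (M := M) φ
  obtain ⟨g, hg, hφg⟩ := (f (s.sup N)).2.2 φ hφ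
  rw [← hψ] at hφg ⊢
  convert hφg using 1
  funext z
  have hz : (z : Y) ∈ E (s.sup N) := hEmono (Finset.le_sup z.2) (hN z)
  rw [hG _ hz, hg hz]

end Saturation

-- Passing to a dense index order

theorem exists_strictMonoOn {I Q : Type*} [LinearOrder I] [Infinite I] [LinearOrder Q]
    (T : Finset Q) : ∃ e : Q → I, StrictMonoOn e T := by
  classical
  obtain ⟨S, hS⟩ := Infinite.exists_subset_card_eq I T.card
  let o : T ≃o S := (T.orderIsoOfFin rfl).symm.trans (S.orderIsoOfFin hS)
  refine ⟨fun x => if hx : x ∈ T then o ⟨x, hx⟩ else Classical.arbitrary I, fun x hx z hz h => ?_⟩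
  simp only [Finset.mem_coe] at hx hz
  simp only [hx, hz, dif_pos]
  exact o.strictMono h

/-- Finitely many mutually indiscernible sequences in a saturated structure can be replaced by
mutually indiscernible sequences with a given countable dense index order, keeping finitely many
terms of each sequence. -/
theorem MutuallyIndiscernibleOn.exists_dense {κ : Cardinal.{w}} (hM : IsSaturated L κ M)
    (hκ : Cardinal.aleph0 < κ) {A : Set M} (hA : Cardinal.mk A < κ) {J : Type y} [Finite J]
    {I : J → Type y} [∀ j, LinearOrder (I j)] [∀ j, Infinite (I j)] {n : J → ℕ}
    {b : (j : J) → I j → Fin (n j) → M} (hb : MutuallyIndiscernibleOn L A Set.univ b)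
    (W : ∀ j, Finset (I j)) (Q : Type y) [LinearOrder Q] [Countable Q] [DenselyOrdered Q]
    [Nontrivial Q] :
    ∃ (b' : (j : J) → Q → Fin (n j) → M) (p : ∀ j, W j ↪o Q),
      MutuallyIndiscernibleOn L A Set.univ b' ∧ ∀ j w, b' j (p j w) = b j w := by
  classical
  have hp : ∀ j, Nonempty (W j ↪o Q) := fun j =>
    Order.embedding_from_countable_to_dense _ _
  let p : ∀ j, W j ↪o Q := fun j => (hp j).some
  let val : (∀ j, Q → I j) → (A ⊕ Σ j, Q × Fin (n j)) → M := fun e =>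
    Sum.elim Subtype.val fun z => b z.1 (e z.1 z.2.1) z.2.2
  -- These formulas hold for every choice of original terms that is increasing on a suitable finite
  -- `T`; they include the equivalences expressing mutual indiscernibility.
  let q : Set (L.Formula (A ⊕ Σ j, Q × Fin (n j))) :=
    {φ | ∃ T : Finset Q, ∀ e : ∀ j, Q → I j, (∀ j, StrictMonoOn (e j) T) → φ.Realize (val e)}
  have htop : ⊤ ∈ q := ⟨∅, fun _ _ => Language.Formula.realize_top.2 trivial⟩
  have hinf : ∀ φ ∈ q, ∀ ψ ∈ q, φ ⊓ ψ ∈ q := by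
    rintro φ ⟨T, hT⟩ ψ ⟨T', hT'⟩
    refine ⟨T ∪ T', fun e he => Language.Formula.realize_inf.2 ⟨hT e fun j => ?_, hT' e fun j => ?_⟩⟩
    · exact (he j).mono (by simp)
    · exact (he j).mono (by simp)
  let e₀ : ∀ j, Q → I j := fun j =>
    Function.extend (p j) Subtype.val fun _ => Classical.arbitrary _
  have he₀ : ∀ j w, e₀ j (p j w) = w := fun j w => (p j).injective.extend_apply _ _ _
  let D : Set (A ⊕ Σ j, Q × Fin (n j)) :=
    Set.range Sum.inl ∪ Set.range fun z : Σ j, W j × Fin (n j) => Sum.inr ⟨z.1, p z.1 z.2.1, z.2.2⟩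
  have hext : Extendable q D (val e₀) := by
    rintro φ ⟨T, hT⟩
    have hfin : (⋃ j, Set.range (p j)).Finite := Set.finite_iUnion fun j => Set.finite_range _
    -- Since `e` is also increasing on the image of `p`, the terms it puts there have the type over
    -- `A` of the terms to be kept.
    choose e he using fun j => exists_strictMonoOn (I := I j) (T ∪ hfin.toFinset)
    refine SameType.exists_extension (SameType.of_exists
      (hb.sameType Set.finite_univ (f := (Subtype.val : A → M)) (fun c => c.2)
        (I₀ := fun j => W j) (s := fun j => Subtype.val) (t := fun j w => e j (p j w))
        (fun j => Subtype.strictMono_coe _) fun j x z hxz => he j ?_ ?_ ((p j).strictMono hxz)) ?_)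
      (hT e fun j => (he j).mono (by simp))
    · simpa using Or.inr ⟨j, x, x.2, rfl⟩
    · simpa using Or.inr ⟨j, z, z.2, rfl⟩
    · rintro ⟨_, ⟨a, rfl⟩ | ⟨⟨j, w, l⟩, rfl⟩⟩
      · exact ⟨Sum.inl a, rfl, rfl⟩
      · exact ⟨Sum.inr ⟨⟨j, trivial⟩, w, l⟩, by simp [val, he₀], rfl⟩
  have hD : Cardinal.mk (val e₀ '' D) < κ := by
    rw [Set.image_union]
    refine (Cardinal.mk_union_le _ _).trans_lt (Cardinal.add_lt_of_lt hκ.le ?_ ?_)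
    · refine (Cardinal.mk_le_mk_of_subset ?_).trans_lt hA
      rintro _ ⟨_, ⟨a, rfl⟩, rfl⟩
      exact a.2
    · exact (Cardinal.lt_aleph0_iff_set_finite.2 ((Set.finite_range _).image _)).trans hκ
  have hc : Dᶜ.Countable := by
    refine (Set.countable_range (Sum.inr : (Σ j, Q × Fin (n j)) → A ⊕ _)).mono ?_
    rintro (a | z) hz
    · exact (hz (Or.inl ⟨a, rfl⟩)).elim
    · exact ⟨z, rfl⟩
  obtain ⟨G, hGD, hG⟩ := hext.exists_realize hM hκ htop hinf hD hc
  have hGA : ∀ a : A, G (Sum.inl a) = a := fun a => hGD (Or.inl ⟨a, rfl⟩)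
  refine ⟨fun j x l => G (Sum.inr ⟨j, x, l⟩), p, fun j _ => ?_, fun j w => ?_⟩
  · refine indiscernible_of_sameType
      (f := fun z : A ⊕ {z : Σ j, Q × Fin (n j) // z.1 ≠ j} => G (Sum.map id Subtype.val z)) ?_
      fun m s t hs ht φ => ?_
    · rintro c (hc | ⟨j', -, hne, x, l, rfl⟩)
      · exact ⟨Sum.inl ⟨c, hc⟩, hGA _⟩
      · exact ⟨Sum.inr ⟨⟨j', x, l⟩, hne⟩, rfl⟩
    · let ρ : (Fin m → Q) → ((A ⊕ {z : Σ j, Q × Fin (n j) // z.1 ≠ j}) ⊕ Fin m × Fin (n j)) →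
          A ⊕ Σ j, Q × Fin (n j) := fun s =>
        Sum.elim (Sum.map id Subtype.val) fun z => Sum.inr ⟨j, s z.1, z.2⟩
      have key := hG ((φ.relabel (ρ s)).iff (φ.relabel (ρ t)))
        ⟨Finset.univ.image s ∪ Finset.univ.image t, fun e he => by
          rw [Language.Formula.realize_iff, Language.Formula.realize_relabel,
            Language.Formula.realize_relabel]
          refine SameType.of_exists ((hb j trivial).sameType
            (f := (Subtype.val : (A ∪ {c | ∃ j' ∈ Set.univ, j' ≠ j ∧ c ∈ entries (b j')} : Set M) → M))
            (fun c => c.2)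
            (s := fun i => e j (s i)) (t := fun i => e j (t i)) ?_ ?_) ?_ φ
          · exact fun i i' h => he j (by simp) (by simp) (hs h)
          · exact fun i i' h => he j (by simp) (by simp) (ht h)
          · rintro ((a | ⟨⟨j', x, l⟩, hne⟩) | z)
            · exact ⟨Sum.inl ⟨a, Or.inl a.2⟩, rfl, rfl⟩
            · exact ⟨Sum.inl ⟨_, Or.inr ⟨j', trivial, hne, e j' x, l, rfl⟩⟩, rfl, rfl⟩
            · exact ⟨Sum.inr z, rfl, rfl⟩⟩
      rw [Language.Formula.realize_iff, Language.Formula.realize_relabel,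
            Language.Formula.realize_relabel] at key
      convert key using 2 <;> · funext z; rcases z with (a | z) | z <;> rfl
  · funext l
    refine (hGD (Or.inr ⟨⟨j, w, l⟩, rfl⟩)).trans ?_
    simp [val, he₀]

end DpRank

-- Subadditivity

theorem mainTheorem1 {L : FirstOrder.Language.{u, v}} (T : L.Theory)
    {M : Type w} [L.Structure M] (κ : Cardinal.{w}) (hM : DpRank.IsMonster T κ M)
    (A : Set M) (hA : Cardinal.mk A < κ)
    {α₁ : Type x₁} {α₂ : Type x₂} [Finite α₁] [Finite α₂]
    (a₁ : α₁ → M) (a₂ : α₂ → M) (k₁ k₂ : ℕ)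
    (h₁ : DpRank.DpRankLE L A (DpRank.tp L A a₁) (k₁ : Cardinal.{y}))
    (h₂ : DpRank.DpRankLE L A (DpRank.tp L A a₂) (k₂ : Cardinal.{y})) :
    DpRank.DpRankLE L A (DpRank.tp L A (Sum.elim a₁ a₂)) ((k₁ + k₂ : ℕ) : Cardinal.{y}) := by
  classical
  intro a ha J hJ I _ _ n b hb
  have hR₁ := h₁.rankLE (a := a ∘ Sum.inl) fun φ hφ => by
    have := ha (φ.relabel Sum.inl) (FirstOrder.Language.Formula.realize_relabel.2 hφ)
    exact FirstOrder.Language.Formula.realize_relabel.1 this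
  have hR₂ := h₂.rankLE (a := a ∘ Sum.inr) fun φ hφ => by
    have := ha (φ.relabel Sum.inr) (FirstOrder.Language.Formula.realize_relabel.2 hφ)
    exact FirstOrder.Language.Formula.realize_relabel.1 this
  have hcard : Nat.card J = 1 + (k₁ + k₂) := by
    rw [Nat.card, hJ]
    exact_mod_cast Cardinal.toNat_natCast.{y} (1 + (k₁ + k₂))
  have hfin : Finite J := Nat.finite_of_card_ne_zero (by omega)
  have := Fintype.ofFinite J
  have : DenselyOrdered (ULift.{y} ℚ) := ⟨fun p q hpq =>
    (exists_between (show p.down < q.down from hpq)).elim fun x hx => ⟨⟨x⟩, hx.1, hx.2⟩⟩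
  have : NoMaxOrder (ULift.{y} ℚ) := ⟨fun p => (exists_gt p.down).elim fun x hx => ⟨⟨x⟩, hx⟩⟩
  have : NoMinOrder (ULift.{y} ℚ) := ⟨fun p => (exists_lt p.down).elim fun x hx => ⟨⟨x⟩, hx⟩⟩
  by_contra! H
  choose F hF m s t hs ht hst using fun j => DpRank.exists_finset_of_not_indiscernible (H j)
  obtain ⟨b', p, hb', hbp⟩ := (DpRank.mutuallyIndiscernible_iff.1 hb).exists_dense hM.saturated
    hM.aleph0_lt hA (fun j => Finset.univ.image (s j) ∪ Finset.univ.image (t j)) (ULift.{y} ℚ)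
  obtain ⟨S, -, hScard, hS⟩ := hR₁.exists_mutuallyIndiscernibleOn (k₂ + 1) A
    (Finset.univ : Finset J)
    (by rw [Finset.card_univ, ← Nat.card_eq_fintype_card, hcard]; omega) (by simpa using hb')
  obtain ⟨⟨j, hj⟩, hind⟩ := hR₂.mono Set.subset_union_left S (by simp [hScard])
    (fun _ => ULift.{y} ℚ) (fun j => n j) (fun j => b' j) (fun j _ => (hS j j.2).mono
      (Set.union_subset_union_right _ fun c ⟨j', _, hne, hc⟩ =>
        ⟨j', j'.2, fun h => hne (Subtype.ext h), hc⟩))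
  refine hst j ((hind.sameType (f := Subtype.val) (fun c => c.2)
    (s := fun i => p j ⟨s j i, by simp⟩) (t := fun i => p j ⟨t j i, by simp⟩)
    (fun _ _ h => (p j).strictMono (hs j h)) (fun _ _ h => (p j).strictMono (ht j h))).of_exists ?_)
  rintro (⟨c, hc⟩ | z)
  · refine ⟨Sum.inl ⟨c, ?_⟩, rfl, rfl⟩
    rcases hF j hc with hc | ⟨i | i, rfl⟩
    · exact Or.inl (Or.inl hc)
    · exact Or.inl (Or.inr ⟨i, rfl⟩)
    · exact Or.inr ⟨i, rfl⟩
  · exact ⟨Sum.inr z, by simp [hbp], by simp [hbp]⟩
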